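/- For a word $w=w_1\cdots w_n$ over the ordered alphabet $[d]=\{1<\dots<d\}$ let $\lambda=(\lambda_1\ge\dots\ge\lambda_d)$, $\lambda_i\in\mathbb{N}$, be its RSK shape, i.e. the sequence of row lengths (padded by zeros) of the tableau obtained by inserting $w_1,\dots,w_n$ successively by Schensted row insertion (an inserted letter bumps the leftmost strictly larger entry of the row into the next row, or is appended to the row if there is no such entry). For a probability distribution $\alpha=(\alpha_1,\dots,\alpha_d)$ on $[d]$ let $\mathrm{SW}_n(\alpha)$ be the law of the RSK shape of a random word whose $n$ letters are drawn independently from $\alpha$. Let $\alpha$ be sorted, $\alpha_1\ge\alpha_2\ge\dots\ge\alpha_d$, let $k\in[d]$, and let $\nu_k=\min\{1,\alpha_k d\}$. Then for every $n\in\mathbb{N}$ $$\alpha_k n-2\sqrt{\nu_k n}\;\le\;\mathop{\mathbf E}_{\lambda\sim \mathrm{SW}_n(\alpha)}[\lambda_k]\;\le\;\alpha_k n+2\sqrt{\nu_k n},$$ and, more precisely, $$\alpha_k n-2\sqrt{\alpha_k k\, n}\;\le\;\mathop{\mathbf E}_{\lambda\sim \mathrm{SW}_n(\alpha)}[\lambda_k]\;\le\;\alpha_k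 n+2\sqrt{(\alpha_k+\alpha_{k+1}+\dots+\alpha_d)\,n}.$$ Moreover, for every $n\in\mathbb{N}$, the expected length of the longest increasing subsequence of a uniformly random permutation of $\{1,\dots,n\}$ is at most $2\sqrt n$. -/

import Mathlib

open MeasureTheory

namespace RSK

/-- Row insertion of the letter `x` into a (weakly increasing) row: `x` replaces the leftmost entry
that is strictly larger than `x`, and that entry is bumped; if there is none, `x` is appended at
the end of the row and nothing is bumped. Returns the new row and the bumped entry, if any. -/
def rowInsert {β : Type*} [LinearOrder β] (x : β) : List β → List β × Option β
  | [] => ([x], none)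
  | y :: r =>
      if x < y then (x :: r, some y)
      else (y :: (rowInsert x r).1, (rowInsert x r).2)

/-- Schensted insertion of `x` into a tableau, given by the list of its rows (top row first):
insert `x` into the first row, the bumped entry into the second row, and so on. -/
def insert {β : Type*} [LinearOrder β] : List (List β) → β → List (List β)
  | [], x => [[x]]
  | r :: T, x =>
      match (rowInsert x r).2 with
      | none => (rowInsert x r).1 :: T
      | some y => (rowInsert x r).1 :: insert T y

/-- The insertion tableau `P` of the word `w₁ ⋯ wₙ`. -/
def tableau {β : Type*} [LinearOrder β] {n : ℕ} (w : Fin n → β) : List (List β) :=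
  (List.ofFn w).foldl insert []

/-- The RSK shape `(λ₁, …, λ_d)` of a word over a `d`-letter alphabet: `λ_k` is the length of the
`k`-th row of the insertion tableau, and is `0` if there is no such row. -/
def shape {n d : ℕ} (w : Fin n → Fin d) : Fin d → ℕ :=
  fun k => ((tableau w).getD k []).length

end RSK

/-- The law of a random letter of the alphabet with probabilities `α`. -/
noncomputable def letterLaw {d : ℕ} (α : Fin d → ℝ) : Measure (Fin d) :=
  ∑ i, ENNReal.ofReal (α i) • Measure.dirac i

/-- The law of the `n`-letter `α`-random word: the letters are independent with law `α`. -/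
noncomputable def wordLaw (n : ℕ) {d : ℕ} (α : Fin d → ℝ) : Measure (Fin n → Fin d) :=
  Measure.pi fun _ => letterLaw α

/-- The Schur–Weyl distribution: the law of the RSK shape of the `n`-letter `α`-random word. -/
noncomputable def schurWeyl (n : ℕ) {d : ℕ} (α : Fin d → ℝ) : Measure (Fin d → ℕ) :=
  (wordLaw n α).map RSK.shape

open Classical in
/-- The length of the longest (weakly) increasing subsequence of `w₁, …, wₙ`; a subsequence is
given by the set of its positions. -/
noncomputable def lis {β : Type*} [LinearOrder β] {n : ℕ} (w : Fin n → β) : ℕ :=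
  (Finset.univ.filter fun s : Finset (Fin n) => MonotoneOn w (s : Set (Fin n))).sup Finset.card

/-- The expected length of the longest increasing subsequence of a uniformly random permutation. -/
noncomputable def expectedLisPerm (n : ℕ) : ℝ :=
  (∑ π : Equiv.Perm (Fin n), (lis π : ℝ)) / (Nat.factorial n : ℝ)

/-! The length of row `k` is squeezed between two Knuth-invariant functions of the word, each
computable letter by letter and each with an easily bounded mean.

Above: in the reading word of the tableau, row `k` is a weakly increasing subword with no letter
below `k`, so its length is at most the longest such subword (`shape_le_lisFrom`). Below: the
letters drive queues in series, where `k` is an arrival and each `a < k` a service. On the reading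
word, at most as many customers leave as row `k` has letters (`foldl_tandemStep_le_shape`).

Both means are estimated by starting from a stationary state, a product of geometric laws. For the
upper bound, the row of letters `≥ k` is stationary if its smallest letter is also removed at a rate
`p = α k + δ`. Since a removal costs at most one unit of length, the mean grows by at most `p` per
letter (`geomListE_rowValue_le`), and the initial row has mean length at most `(∑ i ≥ k, α i) / δ`.
For the lower bound, queues fed at rate `p = α k - δ` are stationary and release customers at rate
`p`; the actual, faster arrivals can only help (`le_geomListE_queueValue_succ`). The initial queues
hold at most `k * α k / δ` customers on average, with `k` counted from zero. Monotonicity compares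
stationary and empty starts, and the choice of `δ` gives the square roots.

For permutations, a uniform word over many letters is at least as favourable to increasing
subsequences as a uniform permutation (`pow_mul_sum_lis_le`). The upper bound for the first row then
tends to `2√n` as the alphabet grows. -/

namespace RSK

/-! ### Knuth equivalence and Schensted insertion. -/

/-- Knuth (plactic) equivalence of words. -/
inductive Knuth {β : Type*} [LinearOrder β] : List β → List β → Prop
  | refl (u : List β) : Knuth u u
  | symm {u v : List β} : Knuth u v → Knuth v u
  | trans {u v w : List β} : Knuth u v → Knuth v w → Knuth u w
  | cons (a : β) {u v : List β} : Knuth u v → Knuth (a :: u) (a :: v)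
  | append_right (t : List β) {u v : List β} : Knuth u v → Knuth (u ++ t) (v ++ t)
  | swap_before {x y z : β} : x ≤ y → y < z → Knuth [x, z, y] [z, x, y]
  | swap_after {x y z : β} : x < y → y ≤ z → Knuth [y, z, x] [y, x, z]

section Knuth

variable {β : Type*} [LinearOrder β]

theorem Knuth.append_left (t : List β) {u v : List β} (h : Knuth u v) :
    Knuth (t ++ u) (t ++ v) := by
  induction t with
  | nil => exact h
  | cons a t ih => exact ih.cons a

/-- Letters acting on a set of states in a way compatible with the Knuth relations give an action
of Knuth classes. -/
theorem Knuth.foldl_eq {S : Type*} {act : S → β → S} {Inv : S → Prop}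
    (hInv : ∀ s a, Inv s → Inv (act s a))
    (hbefore : ∀ s x y z, Inv s → x ≤ y → y < z →
      act (act (act s x) z) y = act (act (act s z) x) y)
    (hafter : ∀ s x y z, Inv s → x < y → y ≤ z →
      act (act (act s y) z) x = act (act (act s y) x) z)
    {u v : List β} (h : Knuth u v) : ∀ s, Inv s → u.foldl act s = v.foldl act s := by
  induction h with
  | refl u => intro s _; rfl
  | symm _ ih => intro s hs; exact (ih s hs).symm
  | trans _ _ ih₁ ih₂ => intro s hs; exact (ih₁ s hs).trans (ih₂ s hs)
  | cons a _ ih => intro s hs; exact ih _ (hInv s a hs)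
  | append_right t _ ih => intro s hs; rw [List.foldl_append, List.foldl_append, ih s hs]
  | swap_before h₁ h₂ => intro s hs; exact hbefore s _ _ _ hs h₁ h₂
  | swap_after h₁ h₂ => intro s hs; exact hafter s _ _ _ hs h₁ h₂

theorem mem_rowInsert {x c : β} {r : List β} (h : c ∈ (rowInsert x r).1) : c = x ∨ c ∈ r := by
  induction r with
  | nil => simpa [rowInsert] using h
  | cons y r ih =>
    unfold rowInsert at h
    split_ifs at h with hxy <;> simp only [List.mem_cons] at h ⊢ <;> tauto

theorem self_mem_rowInsert (x : β) (r : List β) : x ∈ (rowInsert x r).1 := by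
  induction r with
  | nil => simp [rowInsert]
  | cons y r ih => unfold rowInsert; split_ifs <;> simp [ih]

theorem pairwise_rowInsert (x : β) {r : List β} (h : r.Pairwise (· ≤ ·)) :
    (rowInsert x r).1.Pairwise (· ≤ ·) := by
  induction r with
  | nil => simp [rowInsert]
  | cons y r ih =>
    rw [List.pairwise_cons] at h
    unfold rowInsert
    split_ifs with hxy <;> simp only [List.pairwise_cons]
    · exact ⟨fun a ha => hxy.le.trans (h.1 a ha), h.2⟩
    · refine ⟨fun a ha => ?_, ih h.2⟩
      rcases mem_rowInsert ha with rfl | ha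
      · exact not_lt.mp hxy
      · exact h.1 a ha

theorem rowInsert_eq_append {x : β} {r : List β} (h : (rowInsert x r).2 = none) :
    (rowInsert x r).1 = r ++ [x] := by
  induction r with
  | nil => simp [rowInsert]
  | cons y r ih =>
    unfold rowInsert at h ⊢
    split_ifs at h ⊢ with hxy
    simp_all

theorem lt_bumped {x b : β} {r : List β} (h : (rowInsert x r).2 = some b) : x < b := by
  induction r with
  | nil => simp [rowInsert] at h
  | cons y r ih =>
    unfold rowInsert at h
    split_ifs at h with hxy
    · simp_all
    · exact ih h

/-- The small letter `x` travels left through the row: every two adjacent entries `y ≤ z` it meets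
exceed it, so `swap_after` applies. -/
theorem knuth_cons_append {x y : β} {r : List β} (h : (y :: r).Pairwise (· ≤ ·)) (hxy : x < y) :
    Knuth (y :: r ++ [x]) (y :: x :: r) := by
  induction r generalizing y with
  | nil => exact .refl _
  | cons z r ih =>
    have hyz : y ≤ z := by simp_all
    exact ((ih (List.pairwise_cons.mp h).2 (hxy.trans_le hyz)).cons y).trans
      ((Knuth.swap_after hxy hyz).append_right r)

theorem knuth_rowInsert {x b : β} {r : List β} (h : r.Pairwise (· ≤ ·))
    (hb : (rowInsert x r).2 = some b) : Knuth (r ++ [x]) (b :: (rowInsert x r).1) := by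
  induction r with
  | nil => simp [rowInsert] at hb
  | cons y r ih =>
    have h' := List.pairwise_cons.mp h
    unfold rowInsert at hb ⊢
    split_ifs at hb ⊢ with hxy
    · obtain rfl : y = b := by simpa using hb
      exact knuth_cons_append h hxy
    · refine ((ih h'.2 hb).cons y).trans ?_
      have hs := pairwise_rowInsert x h'.2
      have hx := self_mem_rowInsert x r
      have hm : ∀ c ∈ (rowInsert x r).1, y ≤ c := fun c hc => by
        rcases mem_rowInsert hc with rfl | hc
        · exact not_lt.mp hxy
        · exact h'.1 c hc
      revert hs hx hm
      generalize (rowInsert x r).1 = t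
      intro hs hx hm
      match t with
      | [] => simp at hx
      | c :: t =>
        -- The bumped letter `b` must get past `y`. The witness for `swap_before` is the head `c` of
        -- the new row, as `y ≤ c ≤ x < b`.
        have hcx : c ≤ x := by
          rcases List.mem_cons.mp hx with rfl | hx
          · exact le_rfl
          · exact (List.pairwise_cons.mp hs).1 x hx
        exact (Knuth.swap_before (hm c (by simp)) (hcx.trans_lt (lt_bumped hb))).append_right t

/-- The row reading word of a tableau, from the last row to the first one. -/
def reading : List (List β) → List β
  | [] => []
  | r :: T => reading T ++ r

theorem knuth_insert {T : List (List β)} (hT : ∀ r ∈ T, r.Pairwise (· ≤ ·)) (x : β) :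
    Knuth (reading T ++ [x]) (reading (insert T x)) := by
  induction T generalizing x with
  | nil => exact .refl _
  | cons r T ih =>
    unfold insert
    split
    next h => simpa [reading, rowInsert_eq_append h] using Knuth.refl _
    next y h =>
      have h₁ := (knuth_rowInsert (hT r (by simp)) h).append_left (reading T)
      have h₂ := (ih (fun r hr => hT r (by simp [hr])) y).append_right (rowInsert x r).1
      simp only [reading, List.append_assoc, List.singleton_append] at h₁ h₂ ⊢
      exact h₁.trans h₂

end Knuth

/-! ### Rows of the insertion tableau. -/

variable {d : ℕ}

/-- The rows of `T`, numbered from `i` on, are weakly increasing, and the letters of each of them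
are at least its number. -/
def RowsFrom : ℕ → List (List (Fin d)) → Prop
  | _, [] => True
  | i, r :: T => r.Pairwise (· ≤ ·) ∧ (∀ a ∈ r, i ≤ a.val) ∧ RowsFrom (i + 1) T

theorem RowsFrom.pairwise {i : ℕ} {T : List (List (Fin d))} (h : RowsFrom i T) :
    ∀ r ∈ T, r.Pairwise (· ≤ ·) := by
  induction T generalizing i with
  | nil => simp
  | cons r T ih =>
    intro s hs
    rcases List.mem_cons.mp hs with rfl | hs
    · exact h.1
    · exact ih h.2.2 s hs

theorem RowsFrom.le_of_mem_reading {i : ℕ} {T : List (List (Fin d))} (h : RowsFrom i T)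
    {a : Fin d} (ha : a ∈ reading T) : i ≤ a.val := by
  induction T generalizing i with
  | nil => simp [reading] at ha
  | cons r T ih =>
    rcases List.mem_append.mp ha with ha | ha
    · exact (Nat.le_succ i).trans (ih h.2.2 ha)
    · exact h.2.1 a ha

/-- A bumped letter is strictly larger than the one that bumps it, so the lower bound on letters
rises by one with each row. This is all that is needed of column strictness. -/
theorem RowsFrom.insert {i : ℕ} {T : List (List (Fin d))} (h : RowsFrom i T) {x : Fin d}
    (hx : i ≤ x.val) : RowsFrom i (RSK.insert T x) := by
  induction T generalizing i x with
  | nil => simp [RSK.insert, RowsFrom, hx]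
  | cons r T ih =>
    have hrow : ∀ a ∈ (rowInsert x r).1, i ≤ a.val := fun a ha => by
      rcases mem_rowInsert ha with rfl | ha
      · exact hx
      · exact h.2.1 a ha
    unfold RSK.insert
    split
    next => exact ⟨pairwise_rowInsert x h.1, hrow, h.2.2⟩
    next y hy =>
      have : x < y := lt_bumped hy
      exact ⟨pairwise_rowInsert x h.1, hrow, ih h.2.2 (by omega)⟩

theorem RowsFrom.getD {i : ℕ} {T : List (List (Fin d))} (h : RowsFrom i T) (j : ℕ) :
    (T.getD j []).Pairwise (· ≤ ·) ∧ (∀ a ∈ T.getD j [], i + j ≤ a.val) ∧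
      (T.getD j []).Sublist (reading T) := by
  induction T generalizing i j with
  | nil => simp
  | cons r T ih =>
    cases j with
    | zero => exact ⟨h.1, h.2.1, List.sublist_append_right _ _⟩
    | succ j =>
      obtain ⟨h₁, h₂, h₃⟩ := ih h.2.2 j
      refine ⟨by simpa using h₁, fun a ha => ?_, ?_⟩
      · have := h₂ a (by simpa using ha)
        omega
      · exact (by simpa using h₃ : ((r :: T).getD (j + 1) []).Sublist (reading T)).trans
          (List.sublist_append_left _ _)

theorem RowsFrom.foldl_insert {T : List (List (Fin d))} (h : RowsFrom 0 T) (w : List (Fin d)) :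
    RowsFrom 0 (w.foldl RSK.insert T) ∧ Knuth (reading T ++ w) (reading (w.foldl RSK.insert T)) := by
  induction w generalizing T with
  | nil => exact ⟨h, by simpa using Knuth.refl _⟩
  | cons a w ih =>
    obtain ⟨h₁, h₂⟩ := ih (h.insert (Nat.zero_le a.val))
    refine ⟨h₁, .trans ?_ h₂⟩
    simpa using (knuth_insert h.pairwise a).append_right w

theorem rowsFrom_tableau {n : ℕ} (w : Fin n → Fin d) : RowsFrom 0 (tableau w) :=
  (RowsFrom.foldl_insert (T := []) trivial _).1

theorem knuth_tableau {n : ℕ} (w : Fin n → Fin d) :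
    Knuth (List.ofFn w) (reading (tableau w)) :=
  (RowsFrom.foldl_insert (T := []) trivial _).2

end RSK

namespace RSK

/-! ### The upper functional: increasing subsequences. -/

section Increasing

/-- The effect of appending the letter `a` to a word on the function `G`, where `G j` is the length
of the longest weakly increasing subsequence with letters at most `j`. -/
def lisStep (G : ℕ → ℕ) (a : ℕ) : ℕ → ℕ :=
  fun j => if a ≤ j then max (G j) (G a + 1) else G j

/-- `lisStep` for the subsequences without letters below `k`, the letters being renumbered
from `k` on. -/
def lisStepFrom {d : ℕ} (k : ℕ) (G : ℕ → ℕ) (a : Fin d) : ℕ → ℕ :=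
  if a.val < k then G else lisStep G (a.val - k)

theorem monotone_lisStep {G : ℕ → ℕ} (hG : Monotone G) (a : ℕ) : Monotone (lisStep G a) := by
  intro i j hij
  have := hG hij
  unfold lisStep
  split_ifs <;> omega

theorem lisStep_mono {G H : ℕ → ℕ} (h : G ≤ H) (a : ℕ) : lisStep G a ≤ lisStep H a := by
  intro j
  have h₁ : G j ≤ H j := h j
  have h₂ : G a ≤ H a := h a
  simp only [lisStep]
  split_ifs <;> omega

theorem le_lisStep (G : ℕ → ℕ) (a : ℕ) : G ≤ lisStep G a := by
  intro j
  simp only [lisStep]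
  split_ifs <;> omega

theorem lisStep_add_one (G : ℕ → ℕ) (a : ℕ) :
    lisStep (fun j => G j + 1) a = fun j => lisStep G a j + 1 := by
  funext j
  simp only [lisStep]
  split_ifs <;> omega

theorem lisStep_swap_before (G : ℕ → ℕ) {x y z : ℕ} (hxy : x ≤ y) (hyz : y < z) :
    lisStep (lisStep (lisStep G x) z) y = lisStep (lisStep (lisStep G z) x) y := by
  funext j
  simp only [lisStep]
  split_ifs <;> omega

theorem lisStep_swap_after {G : ℕ → ℕ} (hG : Monotone G) {x y z : ℕ} (hxy : x < y) (hyz : y ≤ z) :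
    lisStep (lisStep (lisStep G y) z) x = lisStep (lisStep (lisStep G y) x) z := by
  funext j
  have := hG hxy.le
  simp only [lisStep]
  split_ifs <;> omega

variable {d : ℕ} (k : ℕ)

theorem monotone_lisStepFrom {G : ℕ → ℕ} (hG : Monotone G) (a : Fin d) :
    Monotone (lisStepFrom k G a) := by
  unfold lisStepFrom
  split_ifs
  exacts [hG, monotone_lisStep hG _]

theorem foldl_lisStepFrom_mono {G H : ℕ → ℕ} (h : G ≤ H) (w : List (Fin d)) :
    w.foldl (lisStepFrom k) G ≤ w.foldl (lisStepFrom k) H := by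
  induction w generalizing G H with
  | nil => exact h
  | cons a w ih =>
    refine ih ?_
    unfold lisStepFrom
    split_ifs
    exacts [h, lisStep_mono h _]

theorem foldl_lisStepFrom_add_one (G : ℕ → ℕ) (w : List (Fin d)) :
    w.foldl (lisStepFrom k) (fun j => G j + 1) = fun j => w.foldl (lisStepFrom k) G j + 1 := by
  induction w generalizing G with
  | nil => rfl
  | cons a w ih =>
    have : lisStepFrom k (fun j => G j + 1) a = fun j => lisStepFrom k G a j + 1 := by
      unfold lisStepFrom
      split_ifs
      exacts [rfl, lisStep_add_one _ _]
    rw [List.foldl_cons, this, ih, List.foldl_cons]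

theorem foldl_lisStepFrom_knuth {u v : List (Fin d)} (h : Knuth u v) :
    u.foldl (lisStepFrom k) (fun _ => 0) = v.foldl (lisStepFrom k) (fun _ => 0) := by
  refine h.foldl_eq (Inv := Monotone) (fun G a hG => monotone_lisStepFrom k hG a) ?_ ?_ _
    monotone_const
  · intro G x y z hG hxy hyz
    have hxy : x.val ≤ y.val := hxy
    have hyz : y.val < z.val := hyz
    by_cases hx : x.val < k
    -- The smallest letter acts trivially, and the two words agree once it is deleted.
    · simp [lisStepFrom, hx]
    · simp only [lisStepFrom, hx, if_false, show ¬ y.val < k by omega, show ¬ z.val < k by omega]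
      exact lisStep_swap_before G (by omega) (by omega)
  · intro G x y z hG hxy hyz
    have hxy : x.val < y.val := hxy
    have hyz : y.val ≤ z.val := hyz
    by_cases hx : x.val < k
    · simp [lisStepFrom, hx]
    · simp only [lisStepFrom, hx, if_false, show ¬ y.val < k by omega, show ¬ z.val < k by omega]
      exact lisStep_swap_after hG (by omega) (by omega)

/-- Induction along the subword, with `c` a lower bound for the letters still to come: reading a
letter of `r` moves `c` up to it and raises the value of `G` there by one. -/
theorem add_length_le_foldl_lisStepFrom {G : ℕ → ℕ} (hG : Monotone G) {r w : List (Fin d)}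
    (hrw : r.Sublist w) (hr : r.Pairwise (· ≤ ·)) (c : ℕ) (hc : ∀ a ∈ r, k + c ≤ a.val)
    {j : ℕ} (hcj : c ≤ j) (hj : ∀ a ∈ r, a.val ≤ k + j) :
    G c + r.length ≤ w.foldl (lisStepFrom k) G j := by
  induction hrw generalizing G c with
  | slnil => simpa using hG hcj
  | cons a _ ih =>
    refine le_trans ?_ (ih (monotone_lisStepFrom k hG a) hr c hc hcj hj)
    have : G c ≤ lisStepFrom k G a c := by
      unfold lisStepFrom
      split_ifs
      exacts [le_rfl, le_lisStep G _ c]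
    omega
  | cons_cons a _ ih =>
    have ha : k + c ≤ a.val := hc a (by simp)
    have haj : a.val ≤ k + j := hj a (by simp)
    have hr' := List.pairwise_cons.mp hr
    refine le_trans ?_ (ih (monotone_lisStepFrom k hG a) hr'.2 (a.val - k)
      (fun b hb => ?_) (by omega) (fun b hb => hj b (by simp [hb])))
    · have : lisStepFrom k G a (a.val - k) = max (G (a.val - k)) (G (a.val - k) + 1) := by
        simp [lisStepFrom, lisStep, show ¬ a.val < k by omega]
      have := hG (show c ≤ a.val - k by omega)
      simp only [List.length_cons]
      omega
    · have : a.val ≤ b.val := hr'.1 b hb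
      omega

/-- The length of the longest weakly increasing subsequence of `w` without letters below `k`. -/
def lisFrom (w : List (Fin d)) : ℕ := w.foldl (lisStepFrom k) (fun _ => 0) d

theorem length_le_lisFrom {r w : List (Fin d)} (hrw : r.Sublist w) (hr : r.Pairwise (· ≤ ·))
    (hk : ∀ a ∈ r, k ≤ a.val) : r.length ≤ lisFrom k w := by
  simpa [lisFrom] using add_length_le_foldl_lisStepFrom k (G := fun _ => 0) monotone_const hrw hr 0
    (by simpa using hk) (Nat.zero_le d) (fun a _ => by omega)

theorem shape_le_lisFrom {n : ℕ} (w : Fin n → Fin d) (k : Fin d) :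
    shape w k ≤ lisFrom k (List.ofFn w) := by
  obtain ⟨h₁, h₂, h₃⟩ := (rowsFrom_tableau w).getD k
  rw [lisFrom, foldl_lisStepFrom_knuth k (knuth_tableau w)]
  exact length_le_lisFrom k h₃ h₁ (by simpa using h₂)

end Increasing

/-! ### The lower functional: queues in series. -/

section Tandem

/-- A system of queues in series: `c j` is the number of customers that have passed stage `j`. The
letter `k` lets a new customer in, at stage `k`, and a letter `a < k` lets a customer that has
passed stage `a + 1`, if there is one waiting, pass stage `a`. -/
def tandemStep {d : ℕ} (k : ℕ) (c : ℕ → ℕ) (a : Fin d) : ℕ → ℕ :=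
  fun j => if a.val < k then (if j = a.val then min (c j + 1) (c (j + 1)) else c j)
    else if a.val = k ∧ k ≤ j then c j + 1 else c j

variable {d : ℕ} (k : ℕ)

theorem monotone_tandemStep {c : ℕ → ℕ} (hc : Monotone c) (a : Fin d) :
    Monotone (tandemStep k c a) := by
  refine monotone_nat_of_le_succ fun j => ?_
  have := hc (Nat.le_succ j)
  have := hc (Nat.le_succ (j + 1))
  simp only [tandemStep, Nat.succ_eq_add_one] at *
  split_ifs <;> omega

theorem foldl_tandemStep_mono {c e : ℕ → ℕ} (h : c ≤ e) (w : List (Fin d)) :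
    w.foldl (tandemStep k) c ≤ w.foldl (tandemStep k) e := by
  induction w generalizing c e with
  | nil => exact h
  | cons a w ih =>
    refine ih fun j => ?_
    have h₁ : c j ≤ e j := h j
    have h₂ : c (j + 1) ≤ e (j + 1) := h (j + 1)
    simp only [tandemStep]
    split_ifs <;> omega

theorem foldl_tandemStep_add (c : ℕ → ℕ) (m : ℕ) (w : List (Fin d)) :
    w.foldl (tandemStep k) (fun j => m + c j) = fun j => m + w.foldl (tandemStep k) c j := by
  induction w generalizing c with
  | nil => rfl
  | cons a w ih =>
    have : tandemStep k (fun j => m + c j) a = fun j => m + tandemStep k c a j := by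
      funext j
      simp only [tandemStep]
      split_ifs <;> omega
    rw [List.foldl_cons, this, ih, List.foldl_cons]

/-- Letters that differ by at least two commute. The cases with content are therefore `a, a+1, a`
against `a+1, a, a`, and `a+1, a+1, a` against `a+1, a, a+1`, where monotonicity of `c` makes the
minima agree. -/
theorem foldl_tandemStep_knuth {u v : List (Fin d)} (h : Knuth u v) :
    u.foldl (tandemStep k) (fun _ => 0) = v.foldl (tandemStep k) (fun _ => 0) := by
  refine h.foldl_eq (Inv := Monotone) (fun G a hG => monotone_tandemStep k hG a) ?_ ?_ _
    monotone_const
  · rintro c ⟨x, _⟩ ⟨y, _⟩ ⟨z, _⟩ hc hxy hyz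
    simp only [Fin.mk_le_mk, Fin.mk_lt_mk] at hxy hyz
    funext j
    have := hc (Nat.le_succ j)
    have := hc (Nat.le_succ (j + 1))
    simp only [tandemStep, Nat.succ_eq_add_one] at *
    grind
  · rintro c ⟨x, _⟩ ⟨y, _⟩ ⟨z, _⟩ hc hxy hyz
    simp only [Fin.mk_le_mk, Fin.mk_lt_mk] at hxy hyz
    funext j
    have := hc (Nat.le_succ j)
    have := hc (Nat.le_succ (j + 1))
    simp only [tandemStep, Nat.succ_eq_add_one] at *
    grind

theorem monotone_foldl_tandemStep {c : ℕ → ℕ} (hc : Monotone c) (w : List (Fin d)) :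
    Monotone (w.foldl (tandemStep k) c) := by
  induction w generalizing c with
  | nil => exact hc
  | cons a w ih => exact ih (monotone_tandemStep k hc a)

theorem foldl_tandemStep_eq_of_lt (c : ℕ → ℕ) {i : ℕ} {r : List (Fin d)}
    (hr : ∀ a ∈ r, i < a.val) : r.foldl (tandemStep k) c i = c i := by
  induction r generalizing c with
  | nil => rfl
  | cons a r ih =>
    have := hr a (by simp)
    rw [List.foldl_cons, ih _ fun b hb => hr b (by simp [hb])]
    simp only [tandemStep]
    split_ifs <;> omega

theorem foldl_tandemStep_le_add_length (c : ℕ → ℕ) (i : ℕ) (r : List (Fin d)) :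
    r.foldl (tandemStep k) c i ≤ c i + r.length := by
  induction r generalizing c with
  | nil => simp
  | cons a r ih =>
    refine (ih _).trans ?_
    have : tandemStep k c a i ≤ c i + 1 := by
      simp only [tandemStep]
      split_ifs <;> omega
    simp only [List.length_cons]
    omega

/-- In a sorted row the letters `i` come first, so they act while stage `i + 1` is still frozen and
cannot take `c i` beyond `c (i + 1)`; the later letters leave `c i` alone. -/
theorem foldl_tandemStep_row_le {c : ℕ → ℕ} {i m : ℕ} (hi : i < k) (h₀ : c i ≤ m)
    (h₁ : c (i + 1) ≤ m) {r : List (Fin d)} (hr : r.Pairwise (· ≤ ·)) (hir : ∀ a ∈ r, i ≤ a.val) :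
    r.foldl (tandemStep k) c i ≤ m := by
  induction r generalizing c with
  | nil => exact h₀
  | cons a r ih =>
    have hr' := List.pairwise_cons.mp hr
    rcases (hir a (by simp)).eq_or_lt with ha | ha
    · refine ih ?_ ?_ hr'.2 fun b hb => hir b (by simp [hb])
      · simp only [tandemStep]
        split_ifs <;> omega
      · simp only [tandemStep]
        split_ifs <;> omega
    · rw [foldl_tandemStep_eq_of_lt k c]
      · exact h₀
      · intro b hb
        rcases List.mem_cons.mp hb with rfl | hb
        · exact ha
        · exact ha.trans_le (hr'.1 b hb)

/-- The reading word starts with the lowest rows. Rows below row `k` let nobody in, row `k` lets in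
at most its length, and each row `i < k` lets no more pass stage `i` than the lower rows let pass
stage `i + 1`. -/
theorem RowsFrom.foldl_tandemStep_reading_le {i : ℕ} {T : List (List (Fin d))} (h : RowsFrom i T)
    (hi : i ≤ k) :
    (reading T).foldl (tandemStep k) (fun _ => 0) i ≤ (T.getD (k - i) []).length := by
  induction T generalizing i with
  | nil => simp [reading]
  | cons r T ih =>
    rw [reading, List.foldl_append]
    rcases hi.eq_or_lt with rfl | hi
    · refine (foldl_tandemStep_le_add_length _ _ _ _).trans ?_
      rw [foldl_tandemStep_eq_of_lt _ _ fun a ha => h.2.2.le_of_mem_reading ha]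
      simp
    · have h₁ := ih h.2.2 hi
      rw [show k - i = (k - (i + 1)) + 1 by omega, List.getD_cons_succ]
      exact foldl_tandemStep_row_le k hi
        ((monotone_foldl_tandemStep k monotone_const _ (Nat.le_succ i)).trans h₁) h₁ h.1 h.2.1

theorem foldl_tandemStep_le_shape {n : ℕ} (w : Fin n → Fin d) (k : Fin d) :
    (List.ofFn w).foldl (tandemStep k) (fun _ => 0) 0 ≤ shape w k := by
  rw [foldl_tandemStep_knuth k (knuth_tableau w)]
  simpa [shape] using (rowsFrom_tableau w).foldl_tandemStep_reading_le k (Nat.zero_le _)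

end Tandem

end RSK

namespace RSK

open scoped ENNReal

/-! ### Products of geometric laws. -/

section Geometric

/-- The expectation of `f` under the geometric law with weights `(1 - r) * r ^ n`. -/
noncomputable def geomE (r : ℝ≥0∞) (f : ℕ → ℝ≥0∞) : ℝ≥0∞ := ∑' n, (1 - r) * r ^ n * f n

theorem geomE_add (r : ℝ≥0∞) (f g : ℕ → ℝ≥0∞) :
    geomE r (fun n => f n + g n) = geomE r f + geomE r g := by
  simp only [geomE, mul_add, ENNReal.tsum_add]

theorem geomE_mul_left (r c : ℝ≥0∞) (f : ℕ → ℝ≥0∞) :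
    geomE r (fun n => c * f n) = c * geomE r f := by
  simp only [geomE, ← ENNReal.tsum_mul_left]
  exact tsum_congr fun n => by ring

theorem geomE_mono (r : ℝ≥0∞) {f g : ℕ → ℝ≥0∞} (h : ∀ n, f n ≤ g n) :
    geomE r f ≤ geomE r g :=
  ENNReal.tsum_le_tsum fun n => mul_le_mul_right (h n) _

theorem geomE_const {r : ℝ≥0∞} (hr : r < 1) (c : ℝ≥0∞) : geomE r (fun _ => c) = c := by
  rw [geomE, ENNReal.tsum_mul_right, ENNReal.tsum_mul_left, ENNReal.tsum_geometric,
    ENNReal.mul_inv_cancel (tsub_pos_of_lt hr).ne' (by simp), one_mul]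

/-- Memorylessness, the one property of the geometric law behind both stationarity statements. -/
theorem geomE_eq (r : ℝ≥0∞) (f : ℕ → ℝ≥0∞) :
    geomE r f = (1 - r) * f 0 + r * geomE r (fun n => f (n + 1)) := by
  rw [geomE, tsum_eq_zero_add' ENNReal.summable, geomE, ← ENNReal.tsum_mul_left]
  congr 1
  · simp
  · exact tsum_congr fun n => by ring

theorem geomE_natCast {r : ℝ≥0∞} (hr : r < 1) : geomE r (fun n => (n : ℝ≥0∞)) = r / (1 - r) := by
  lift r to NNReal using (hr.trans ENNReal.one_lt_top).ne
  have hr' : (r : ℝ) < 1 := by exact_mod_cast hr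
  have h := (hasSum_coe_mul_geometric_of_norm_lt_one (r := (r : ℝ))
    (by simpa using hr')).mul_left (1 - (r : ℝ))
  have h₁ : (1 - (r : ℝ)) ≠ 0 := by linarith
  have h₂ : ∀ n : ℕ, (1 - (r : ℝ≥0∞)) * (r : ℝ≥0∞) ^ n * (n : ℝ≥0∞)
      = ENNReal.ofReal ((1 - (r : ℝ)) * (n * (r : ℝ) ^ n)) := fun n => by
    rw [ENNReal.ofReal_mul (by linarith), ENNReal.ofReal_mul (by positivity),
      ENNReal.ofReal_sub _ (by positivity), ENNReal.ofReal_pow (by positivity)]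
    simp
    ring
  rw [geomE, tsum_congr h₂, ← ENNReal.ofReal_tsum_of_nonneg _ h.summable, h.tsum_eq]
  · rw [show (1 - (r : ℝ)) * (r / (1 - r) ^ 2) = r / (1 - r) by field_simp,
      ENNReal.ofReal_div_of_pos (by linarith), ENNReal.ofReal_sub _ (by positivity)]
    simp
  · intro n
    exact mul_nonneg (by linarith) (by positivity)

/-- The expectation of `φ` under the law of a list of `m` independent geometric variables with
parameters `r 0, r 1, …`. -/
noncomputable def geomListE : ℕ → (ℕ → ℝ≥0∞) → (List ℕ → ℝ≥0∞) → ℝ≥0∞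
  | 0, _, φ => φ []
  | m + 1, r, φ => geomE (r 0) fun n => geomListE m (fun i => r (i + 1)) fun y => φ (n :: y)

variable {m : ℕ} {r : ℕ → ℝ≥0∞}

theorem geomListE_add (φ ψ : List ℕ → ℝ≥0∞) :
    geomListE m r (fun x => φ x + ψ x) = geomListE m r φ + geomListE m r ψ := by
  induction m generalizing r φ ψ with
  | zero => rfl
  | succ m ih => simp only [geomListE, ih, geomE_add]

theorem geomListE_mul_left (c : ℝ≥0∞) (φ : List ℕ → ℝ≥0∞) :
    geomListE m r (fun x => c * φ x) = c * geomListE m r φ := by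
  induction m generalizing r φ with
  | zero => rfl
  | succ m ih => simp only [geomListE, ih, geomE_mul_left]

theorem geomListE_sum {ι : Type*} (s : Finset ι) (φ : ι → List ℕ → ℝ≥0∞) :
    geomListE m r (fun x => ∑ i ∈ s, φ i x) = ∑ i ∈ s, geomListE m r (φ i) := by
  classical
  induction s using Finset.induction_on with
  | empty =>
    simpa using geomListE_mul_left (m := m) (r := r) 0 (fun _ => 0)
  | insert i s hi ih => simp only [Finset.sum_insert hi, geomListE_add, ih]

theorem geomListE_mono {φ ψ : List ℕ → ℝ≥0∞} (h : ∀ x, x.length = m → φ x ≤ ψ x) :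
    geomListE m r φ ≤ geomListE m r ψ := by
  induction m generalizing r φ ψ with
  | zero => exact h [] rfl
  | succ m ih => exact geomE_mono _ fun n => ih fun y hy => h (n :: y) (by simp [hy])

theorem geomListE_congr {φ ψ : List ℕ → ℝ≥0∞} (h : ∀ x, x.length = m → φ x = ψ x) :
    geomListE m r φ = geomListE m r ψ :=
  (geomListE_mono fun x hx => (h x hx).le).antisymm (geomListE_mono fun x hx => (h x hx).ge)

theorem geomListE_const (hr : ∀ i < m, r i < 1) (c : ℝ≥0∞) :
    geomListE m r (fun _ => c) = c := by
  induction m generalizing r with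
  | zero => rfl
  | succ m ih =>
    simp only [geomListE, ih fun i hi => hr (i + 1) (by omega)]
    exact geomE_const (hr 0 (by omega)) c

theorem geomListE_sum_natCast (hr : ∀ i < m, r i < 1) :
    geomListE m r (fun x => (x.sum : ℝ≥0∞)) = ∑ i ∈ Finset.range m, r i / (1 - r i) := by
  induction m generalizing r with
  | zero => simp [geomListE]
  | succ m ih =>
    have hr' : ∀ i < m, r (i + 1) < 1 := fun i hi => hr (i + 1) (by omega)
    simp only [geomListE, List.sum_cons, Nat.cast_add, geomListE_add, ih hr',
      geomListE_const hr', geomE_add, geomE_const (hr 0 (by omega)), geomE_natCast (hr 0 (by omega))]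
    rw [Finset.sum_range_succ', add_comm]

end Geometric

/-! ### Stationarity of the row. -/

section RowChain

/-- Remove the smallest letter of the row in which the letter `i` occurs `x[i]` times. -/
def removeMin : List ℕ → List ℕ
  | [] => []
  | 0 :: y => 0 :: removeMin y
  | (n + 1) :: y => n :: y

/-- Insert a letter into the row in which the letter `i` occurs `x[i]` times. -/
def insertCount : ℕ → List ℕ → List ℕ
  | _, [] => []
  | 0, n :: y => (n + 1) :: removeMin y
  | i + 1, n :: y => n :: insertCount i y

/-- The number of letters up to `j` in the row in which the letter `i` occurs `x[i]` times. -/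
def countUpTo (x : List ℕ) : ℕ → ℕ := fun j => (x.take (j + 1)).sum

theorem sum_take_removeMin (x : List ℕ) (j : ℕ) :
    ((removeMin x).take j).sum = (x.take j).sum - 1 := by
  induction x generalizing j with
  | nil => simp [removeMin]
  | cons n y ih =>
    cases j with
    | zero => simp
    | succ j =>
      cases n with
      | zero => simp [removeMin, ih]
      | succ n => simp [removeMin, add_right_comm]

/-- Adding `i` and deleting the smallest larger letter `b` raises the count up to `j` exactly for `i
≤ j < b`, which is where the old count equals the count up to `i`. -/
theorem countUpTo_insertCount (x : List ℕ) {i : ℕ} (hi : i < x.length) :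
    countUpTo (insertCount i x) = lisStep (countUpTo x) i := by
  induction x generalizing i with
  | nil => simp at hi
  | cons n y ih =>
    funext j
    cases i with
    | zero =>
      simp only [countUpTo, insertCount, lisStep, List.take_succ_cons, List.sum_cons,
        sum_take_removeMin, List.take_zero, List.sum_nil, Nat.zero_le, if_true]
      omega
    | succ i =>
      have h := ih (i := i) (by simpa using hi)
      cases j with
      | zero => simp [countUpTo, insertCount, lisStep]
      | succ j =>
        have h := congrFun h j
        simp only [countUpTo, insertCount, lisStep, List.take_succ_cons, List.sum_cons] at h ⊢
        rw [h]
        split_ifs <;> omega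

theorem countUpTo_le_removeMin (x : List ℕ) :
    countUpTo x ≤ fun j => countUpTo (removeMin x) j + 1 := by
  intro j
  simp only [countUpTo, sum_take_removeMin]
  omega

/-- The product of geometric laws is stationary for the row to which each letter `i` is added
at the rate `r i` and whose smallest letter is removed at the rate `1`. -/
theorem geomListE_insertCount (m : ℕ) (r : ℕ → ℝ≥0∞) (φ : List ℕ → ℝ≥0∞) :
    geomListE m r (fun x => φ (removeMin x)) +
        ∑ i ∈ Finset.range m, r i * geomListE m r (fun x => φ (insertCount i x)) =
      (1 + ∑ i ∈ Finset.range m, r i) * geomListE m r φ := by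
  induction m generalizing r φ with
  | zero => simp [geomListE, removeMin]
  | succ m ih =>
    set r' : ℕ → ℝ≥0∞ := fun i => r (i + 1)
    set A : ℕ → ℝ≥0∞ := fun n => geomListE m r' fun y => φ (n :: y)
    set B : ℕ → ℝ≥0∞ := fun n => geomListE m r' fun y => φ (n :: removeMin y)
    set C : ℕ → ℝ≥0∞ := fun n =>
      ∑ i ∈ Finset.range m, r' i * geomListE m r' fun y => φ (n :: insertCount i y)
    have hBC : ∀ n, B n + C n = (1 + ∑ i ∈ Finset.range m, r' i) * A n := fun n =>
      ih r' fun y => φ (n :: y)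
    have h₁ : geomListE (m + 1) r (fun x => φ (removeMin x)) =
        (1 - r 0) * B 0 + r 0 * geomE (r 0) A := geomE_eq _ _
    have h₂ : ∑ i ∈ Finset.range m, r (i + 1) *
        geomListE (m + 1) r (fun x => φ (insertCount (i + 1) x)) = geomE (r 0) C := by
      simp only [geomListE, insertCount, ← geomE_mul_left]
      symm
      simp only [C, geomE, Finset.mul_sum]
      exact Summable.tsum_finsetSum fun i _ => ENNReal.summable
    have h₃ : geomListE (m + 1) r (fun x => φ (insertCount 0 x)) =
        geomE (r 0) fun n => B (n + 1) := rfl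
    rw [Finset.sum_range_succ', Finset.sum_range_succ', h₁, h₂, h₃]
    -- Removals from the tail have two sources: a removal when the letter `0` is absent (`B 0`), and
    -- the insertion of a `0` (`B (n + 1)`). By memorylessness they add up to removal from an
    -- independent tail at rate `1`, so the induction hypothesis applies.
    calc _ = ((1 - r 0) * B 0 + r 0 * geomE (r 0) fun n => B (n + 1)) + geomE (r 0) C
          + r 0 * geomE (r 0) A := by ring
      _ = geomE (r 0) (fun n => B n + C n) + r 0 * geomE (r 0) A := by
        rw [← geomE_eq, geomE_add]
      _ = _ := by
        simp only [hBC, geomE_mul_left]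
        rw [show geomListE (m + 1) r φ = geomE (r 0) A from rfl]
        ring

end RowChain

/-! ### Stationarity of the queues and their output. -/

section QueueChain

/-- A customer joins the first of the queues in series with lengths `x`. The second component
counts the customers that leave the system. -/
def push : List ℕ → List ℕ × ℕ
  | [] => ([], 1)
  | n :: y => ((n + 1) :: y, 0)

/-- A customer, if there is one, moves on from the `i`-th of the queues in series with lengths `x`.
The second component counts the customers that leave the system. -/
def serve : ℕ → List ℕ → List ℕ × ℕ
  | _, [] => ([], 0)
  | 0, 0 :: y => (0 :: y, 0)
  | 0, (n + 1) :: y => (n :: (push y).1, (push y).2)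
  | i + 1, n :: y => (n :: (serve i y).1, (serve i y).2)

theorem sum_drop_push (x : List ℕ) (i : ℕ) (hi : i ≤ x.length) :
    (push x).2 + ((push x).1.drop i).sum = (x.drop i).sum + if i = 0 then 1 else 0 := by
  cases x with
  | nil =>
    obtain rfl : i = 0 := by simpa using hi
    simp [push]
  | cons n y =>
    cases i with
    | zero => simp [push]; omega
    | succ i => simp [push]

theorem sum_drop_serve (x : List ℕ) {q : ℕ} (hq : q < x.length) (i : ℕ) (hi : i ≤ x.length) :
    (serve q x).2 + ((serve q x).1.drop i).sum =
      if i = q + 1 then min ((x.drop i).sum + 1) (x.drop q).sum else (x.drop i).sum := by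
  induction x generalizing q i with
  | nil => simp at hq
  | cons n y ih =>
    cases q with
    | zero =>
      cases n with
      | zero =>
        simp only [serve]
        split_ifs with h
        · subst h; simp
        · simp
      | succ n =>
        simp only [serve]
        cases i with
        | zero =>
          have := sum_drop_push y 0 (Nat.zero_le _)
          simp at this ⊢
          omega
        | succ i =>
          have := sum_drop_push y i (by simpa using hi)
          simp only [List.drop_succ_cons, this]
          by_cases h : i = 0
          · subst h; simp
          · simp [h]
    | succ q =>
      have hq' : q < y.length := by simpa using hq
      cases i with
      | zero =>
        have := ih hq' 0 (Nat.zero_le _)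
        simp [serve] at this ⊢
        omega
      | succ i =>
        have := ih hq' i (by simpa using hi)
        simpa [serve] using this

/-- The product of geometric laws is stationary for queues in series with service rates `s i`
and arrivals at the rate `1`, and the customers then leave the system at the rate `1`. -/
theorem geomListE_serve (m : ℕ) (r s : ℕ → ℝ≥0∞) (hrs : ∀ i < m, s i * r i = 1)
    (φ : List ℕ × ℕ → ℝ≥0∞) :
    geomListE m r (fun x => φ (push x)) +
        ∑ i ∈ Finset.range m, s i * geomListE m r (fun x => φ (serve i x)) =
      (∑ i ∈ Finset.range m, s i) * geomListE m r (fun x => φ (x, 0)) +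
        geomListE m r (fun x => φ (x, 1)) := by
  induction m generalizing r s φ with
  | zero => simp [geomListE, push]
  | succ m ih =>
    set r' : ℕ → ℝ≥0∞ := fun i => r (i + 1)
    set s' : ℕ → ℝ≥0∞ := fun i => s (i + 1)
    set A : ℕ → ℝ≥0∞ := fun n => geomListE m r' fun y => φ (n :: y, 0)
    set A₁ : ℕ → ℝ≥0∞ := fun n => geomListE m r' fun y => φ (n :: y, 1)
    set B : ℕ → ℝ≥0∞ := fun n => geomListE m r' fun y => φ (n :: (push y).1, (push y).2)
    set C : ℕ → ℝ≥0∞ := fun n =>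
      ∑ i ∈ Finset.range m, s' i * geomListE m r' fun y => φ (n :: (serve i y).1, (serve i y).2)
    have hBC : ∀ n, B n + C n = (∑ i ∈ Finset.range m, s' i) * A n + A₁ n := fun n =>
      ih r' s' (fun i hi => hrs (i + 1) (by omega)) fun y => φ (n :: y.1, y.2)
    have h₁ : geomListE (m + 1) r (fun x => φ (serve 0 x)) =
        (1 - r 0) * A 0 + r 0 * geomE (r 0) B := geomE_eq _ _
    have h₂ : ∑ i ∈ Finset.range m, s (i + 1) *
        geomListE (m + 1) r (fun x => φ (serve (i + 1) x)) = geomE (r 0) C := by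
      simp only [geomListE, serve, ← geomE_mul_left]
      symm
      simp only [C, geomE, Finset.mul_sum]
      exact Summable.tsum_finsetSum fun i _ => ENNReal.summable
    have h₃ : geomListE (m + 1) r (fun x => φ (push x)) = geomE (r 0) fun n => A (n + 1) := rfl
    have h₀ := hrs 0 (by omega)
    rw [Finset.sum_range_succ', Finset.sum_range_succ', h₁, h₂, h₃]
    -- As `s 0 * r 0 = 1`, the first queue feeds the others at rate `1`, as the induction hypothesis
    -- requires, and its arrivals combine with the idle services to `s 0` times the mean of `A`.
    calc _ = (s 0 * (1 - r 0) * A 0 + 1 * geomE (r 0) fun n => A (n + 1))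
          + ((s 0 * r 0) * geomE (r 0) B + geomE (r 0) C) := by ring
      _ = s 0 * ((1 - r 0) * A 0 + r 0 * geomE (r 0) fun n => A (n + 1))
          + geomE (r 0) (fun n => B n + C n) := by
        rw [geomE_add, mul_add, ← mul_assoc (s 0) (r 0), ← mul_assoc (s 0) (1 - r 0), h₀,
          one_mul (geomE _ B)]
      _ = _ := by
        rw [← geomE_eq]
        simp only [hBC, geomE_mul_left, geomE_add]
        rw [show geomListE (m + 1) r (fun x => φ (x, 0)) = geomE (r 0) A from rfl,
          show geomListE (m + 1) r (fun x => φ (x, 1)) = geomE (r 0) A₁ from rfl]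
        ring

end QueueChain

end RSK

namespace RSK

open scoped ENNReal

/-! ### Random words, read letter by letter. -/

section Words

variable {d : ℕ}

/-- The expectation of `F` under the law of a word of `n` independent letters, with `a` the
probabilities of the letters. -/
noncomputable def wordE (a : Fin d → ℝ≥0∞) : ℕ → (List (Fin d) → ℝ≥0∞) → ℝ≥0∞
  | 0, F => F []
  | n + 1, F => ∑ j, a j * wordE a n fun w => F (j :: w)

theorem wordE_eq_sum (a : Fin d → ℝ≥0∞) (n : ℕ) (F : List (Fin d) → ℝ≥0∞) :
    wordE a n F = ∑ w : Fin n → Fin d, (∏ i, a (w i)) * F (List.ofFn w) := by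
  induction n generalizing F with
  | zero => simp [wordE]
  | succ n ih =>
    rw [← (Fin.consEquiv fun _ : Fin (n + 1) => Fin d).sum_comp, Fintype.sum_prod_type]
    simp only [wordE, ih, Finset.mul_sum, Fin.consEquiv_apply, Fin.prod_univ_succ, Fin.cons_zero,
      Fin.cons_succ, List.ofFn_succ, mul_assoc]

theorem wordE_mono (a : Fin d → ℝ≥0∞) (n : ℕ) {F F' : List (Fin d) → ℝ≥0∞} (h : ∀ w, F w ≤ F' w) :
    wordE a n F ≤ wordE a n F' := by
  induction n generalizing F F' with
  | zero => exact h []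
  | succ n ih =>
    exact Finset.sum_le_sum fun j _ => mul_le_mul_right (ih fun w => h (j :: w)) _

theorem wordE_const_add {a : Fin d → ℝ≥0∞} (ha : ∑ j, a j = 1) (n : ℕ) (c : ℝ≥0∞)
    (F : List (Fin d) → ℝ≥0∞) : wordE a n (fun w => c + F w) = c + wordE a n F := by
  induction n generalizing F with
  | zero => rfl
  | succ n ih =>
    simp only [wordE, ih, mul_add, Finset.sum_add_distrib, ← Finset.sum_mul, ha, one_mul]

end Words

/-! ### Bounds from the stationary starts. -/

section Bounds

variable {d k : ℕ} {a : ℕ → ℝ≥0∞} {p : ℝ≥0∞} {r : ℕ → ℝ≥0∞}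

/-- The expected length of the longest weakly increasing subsequence without letters below `k` of
a word of `n` letters that is appended to the row with the letter counts `x`. -/
noncomputable def rowValue (d k : ℕ) (a : ℕ → ℝ≥0∞) (n : ℕ) (x : List ℕ) : ℝ≥0∞ :=
  wordE (fun j : Fin d => a j) n fun w => (w.foldl (lisStepFrom k) (countUpTo x) d : ℝ≥0∞)

theorem rowValue_le_removeMin (ha : ∑ j ∈ Finset.range d, a j = 1) (n : ℕ) (x : List ℕ) :
    rowValue d k a n x ≤ 1 + rowValue d k a n (removeMin x) := by
  rw [rowValue, rowValue, ← wordE_const_add (by rw [← ha, Fin.sum_univ_eq_sum_range])]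
  refine wordE_mono _ _ fun w => ?_
  have := foldl_lisStepFrom_mono k (countUpTo_le_removeMin x) w d
  rw [foldl_lisStepFrom_add_one] at this
  rw [add_comm]
  exact_mod_cast this

theorem rowValue_succ (n : ℕ) {x : List ℕ} (hx : x.length = d - k) :
    rowValue d k a (n + 1) x = ∑ j ∈ Finset.range d,
      a j * if j < k then rowValue d k a n x else rowValue d k a n (insertCount (j - k) x) := by
  rw [← Fin.sum_univ_eq_sum_range
    (fun j => a j * if j < k then rowValue d k a n x else rowValue d k a n (insertCount (j - k) x))]
  simp only [rowValue, wordE, List.foldl_cons]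
  refine Finset.sum_congr rfl fun j _ => ?_
  by_cases hj : j.val < k
  · simp only [lisStepFrom, hj, if_true]
  · have : j.val - k < x.length := by omega
    simp only [hj, if_false, countUpTo_insertCount x this]
    simp only [lisStepFrom, hj, if_false]

/-- Condition on the first letter: letters below `k` change nothing, and the others are the
insertions of the stationary row with time rescaled by `p`; only the removals have to be added. -/
theorem geomListE_rowValue_succ (hk : k ≤ d) (har : ∀ i < d - k, a (k + i) = p * r i) (n : ℕ) :
    geomListE (d - k) r (rowValue d k a (n + 1)) +
        p * geomListE (d - k) r (fun x => rowValue d k a n (removeMin x)) =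
      (∑ j ∈ Finset.range d, a j + p) * geomListE (d - k) r (rowValue d k a n) := by
  rw [geomListE_congr fun x hx => rowValue_succ n hx, geomListE_sum]
  simp only [geomListE_mul_left]
  obtain ⟨m, rfl⟩ := Nat.exists_eq_add_of_le hk
  simp only [Nat.add_sub_cancel_left] at *
  rw [Finset.sum_range_add, Finset.sum_range_add]
  have h₁ : ∀ j ∈ Finset.range k, a j * geomListE m r (fun x => if j < k then
      rowValue (k + m) k a n x else rowValue (k + m) k a n (insertCount (j - k) x)) =
      a j * geomListE m r (rowValue (k + m) k a n) := fun j hj => by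
    simp [Finset.mem_range.mp hj]
  have h₂ : ∀ i ∈ Finset.range m, a (k + i) * geomListE m r (fun x => if k + i < k then
      rowValue (k + m) k a n x else rowValue (k + m) k a n (insertCount (k + i - k) x)) =
      p * (r i * geomListE m r fun x => rowValue (k + m) k a n (insertCount i x)) := fun i hi => by
    simp [har i (Finset.mem_range.mp hi), mul_assoc]
  rw [Finset.sum_congr rfl h₁, Finset.sum_congr rfl h₂, ← Finset.sum_mul, ← Finset.mul_sum,
    Finset.sum_congr rfl fun i hi => har i (Finset.mem_range.mp hi), ← Finset.mul_sum, add_assoc,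
    ← mul_add, add_comm (Finset.sum _ _) (geomListE _ _ _), geomListE_insertCount]
  ring

theorem geomListE_rowValue_le (hk : k ≤ d) (ha : ∑ j ∈ Finset.range d, a j = 1) (hp : p ≠ ⊤)
    (hr : ∀ i < d - k, r i < 1) (har : ∀ i < d - k, a (k + i) = p * r i) (n : ℕ) :
    geomListE (d - k) r (rowValue d k a n) ≤
      p * n + ∑ i ∈ Finset.range (d - k), r i / (1 - r i) := by
  induction n with
  | zero =>
    rw [← geomListE_sum_natCast hr]
    refine (geomListE_mono fun x hx => ?_).trans le_add_self
    have : x.take (d + 1) = x := List.take_of_length_le (by omega)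
    simp [rowValue, wordE, countUpTo, this]
  | succ n ih =>
    have h := geomListE_rowValue_succ hk har n
    rw [ha] at h
    set H := geomListE (d - k) r (rowValue d k a n)
    set K := geomListE (d - k) r fun x => rowValue d k a n (removeMin x)
    have hHK : H ≤ 1 + K := by
      have h₁ : geomListE (d - k) r (fun x => 1 + rowValue d k a n (removeMin x)) = 1 + K := by
        rw [geomListE_add, geomListE_const hr]
      rw [← h₁]
      exact geomListE_mono fun x _ => rowValue_le_removeMin ha n x
    have hH : H ≠ ⊤ := by
      refine (ih.trans_lt ?_).ne
      refine ENNReal.add_lt_top.mpr ⟨ENNReal.mul_lt_top hp.lt_top (by simp), ?_⟩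
      refine ENNReal.sum_lt_top.mpr fun i hi => ENNReal.div_lt_top ?_ ?_
      · exact ((hr i (Finset.mem_range.mp hi)).trans ENNReal.one_lt_top).ne
      · exact (tsub_pos_of_lt (hr i (Finset.mem_range.mp hi))).ne'
    -- Finiteness is what allows `p * K` to be cancelled in `ℝ≥0∞`.
    have hK : p * K ≠ ⊤ := by
      refine ne_top_of_le_ne_top ?_ (h ▸ le_add_self : p * K ≤ (1 + p) * H)
      exact ENNReal.mul_ne_top (by simp [hp]) hH
    have hle : geomListE (d - k) r (rowValue d k a (n + 1)) ≤ p + H := by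
      refine ENNReal.le_of_add_le_add_right hK ?_
      rw [h]
      calc (1 + p) * H = H + p * H := by ring
        _ ≤ H + p * (1 + K) := by gcongr
        _ = p + H + p * K := by ring
    calc _ ≤ p + H := hle
      _ ≤ p + (p * n + ∑ i ∈ Finset.range (d - k), r i / (1 - r i)) := by gcongr
      _ = _ := by push_cast; ring

theorem wordE_lisFrom_le (hk : k ≤ d) (ha : ∑ j ∈ Finset.range d, a j = 1) (hp : p ≠ ⊤)
    (hr : ∀ i < d - k, r i < 1) (har : ∀ i < d - k, a (k + i) = p * r i) (n : ℕ) :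
    wordE (fun j : Fin d => a j) n (fun w => (lisFrom k w : ℝ≥0∞)) ≤
      p * n + ∑ i ∈ Finset.range (d - k), r i / (1 - r i) := by
  rw [← geomListE_const hr (wordE _ n _)]
  refine le_trans (geomListE_mono fun x _ => ?_) (geomListE_rowValue_le hk ha hp hr har n)
  refine wordE_mono _ _ fun w => ?_
  exact_mod_cast foldl_lisStepFrom_mono k (fun j => Nat.zero_le _) w d

/-- The numbers of customers that have passed the stages of queues in series with lengths `x`, if
none has left the system. -/
def passed (k : ℕ) (x : List ℕ) : ℕ → ℕ := fun j => (x.drop (k - j)).sum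

/-- Queues are listed in the direction of travel while stages count down, so letter `j < k` serves
queue `k - 1 - j`. A customer who leaves has passed every stage and shifts all counts by one. -/
theorem tandemStep_passed {x : List ℕ} (hx : x.length = k) (j : Fin d) :
    tandemStep k (passed k x) j = fun i =>
      (if j.val < k then serve (k - 1 - j) x else if j.val = k then push x else (x, 0)).2 +
        passed k (if j.val < k then serve (k - 1 - j) x else
          if j.val = k then push x else (x, 0)).1 i := by
  funext i
  simp only [tandemStep, passed]
  split_ifs with h₁ h₂ h₃ h₄ h₅
  · rw [sum_drop_serve x (by omega) _ (by omega), if_pos (by omega)]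
    congr 3
    omega
  · rw [sum_drop_serve x (by omega) _ (by omega), if_neg (by omega)]
  · rw [sum_drop_push x _ (by omega), if_pos (by omega)]
  · omega
  · rw [sum_drop_push x _ (by omega), if_neg (by omega), add_zero]
  · simp

/-- The expected number of customers that leave queues in series with lengths `x` during a word of
`n` letters. -/
noncomputable def queueValue (d k : ℕ) (a : ℕ → ℝ≥0∞) (n : ℕ) (x : List ℕ) : ℝ≥0∞ :=
  wordE (fun j : Fin d => a j) n fun w => (w.foldl (tandemStep k) (passed k x) 0 : ℝ≥0∞)

theorem queueValue_succ (ha : ∑ j ∈ Finset.range d, a j = 1) (n : ℕ) {x : List ℕ}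
    (hx : x.length = k) {φ : List ℕ × ℕ → ℝ≥0∞} (hφ : ∀ z, φ z = z.2 + queueValue d k a n z.1) :
    queueValue d k a (n + 1) x = ∑ j ∈ Finset.range d,
      a j * φ (if j < k then serve (k - 1 - j) x else if j = k then push x else (x, 0)) := by
  rw [← Fin.sum_univ_eq_sum_range (fun j => a j * φ (if j < k then serve (k - 1 - j) x else
    if j = k then push x else (x, 0)))]
  simp only [queueValue, wordE, List.foldl_cons, hφ]
  refine Finset.sum_congr rfl fun j _ => ?_
  rw [tandemStep_passed hx j, ← wordE_const_add (by rw [← ha, Fin.sum_univ_eq_sum_range])]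
  simp only [foldl_tandemStep_add, Nat.cast_add]

theorem queueValue_le_push (ha : ∑ j ∈ Finset.range d, a j = 1) (n : ℕ) {x : List ℕ}
    (hx : x.length = k) :
    queueValue d k a n x ≤ (push x).2 + queueValue d k a n (push x).1 := by
  rw [queueValue, queueValue, ← wordE_const_add (by rw [← ha, Fin.sum_univ_eq_sum_range])]
  refine wordE_mono _ _ fun w => ?_
  have h : passed k x ≤ fun i => (push x).2 + passed k (push x).1 i := fun i => by
    simp only [passed]
    rw [sum_drop_push x _ (by omega)]
    exact Nat.le_add_right _ _
  have := foldl_tandemStep_mono k h w 0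
  rw [foldl_tandemStep_add] at this
  exact_mod_cast this

theorem le_geomListE_queueValue_succ (hk : k < d) (ha : ∑ j ∈ Finset.range d, a j = 1)
    {s : ℕ → ℝ≥0∞} (hr : ∀ i < k, r i < 1) (hrs : ∀ i < k, s i * r i = 1)
    (has : ∀ i < k, a (k - 1 - i) = p * s i) (hpk : p ≤ a k) (n : ℕ) :
    p + geomListE k r (queueValue d k a n) ≤ geomListE k r (queueValue d k a (n + 1)) := by
  set φ : List ℕ × ℕ → ℝ≥0∞ := fun z => z.2 + queueValue d k a n z.1 with hφ
  rw [geomListE_congr fun x hx => queueValue_succ ha n hx (φ := φ) fun _ => rfl, geomListE_sum]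
  simp only [geomListE_mul_left]
  set G := geomListE k r (queueValue d k a n)
  have hG₀ : geomListE k r (fun x => φ (x, 0)) = G := by simp [hφ, G]
  have hG₁ : geomListE k r (fun x => φ (x, 1)) = 1 + G := by
    simp [hφ, G, geomListE_add, geomListE_const hr]
  have hGp : G ≤ geomListE k r (fun x => φ (push x)) :=
    geomListE_mono fun x hx => queueValue_le_push ha n hx
  have hst := geomListE_serve k r s hrs φ
  rw [hG₀, hG₁] at hst
  set P := geomListE k r (fun x => φ (push x))
  obtain ⟨m, rfl⟩ := Nat.exists_eq_add_of_le hk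
  -- Arrivals split into a part of rate `p`, balanced with the services by stationarity, and an
  -- excess `δ`, for which `hGp` suffices.
  obtain ⟨δ, hδ⟩ := exists_add_of_le hpk
  have h₁ : ∑ j ∈ Finset.range k, a j * geomListE k r (fun x => φ (if j < k then
        serve (k - 1 - j) x else if j = k then push x else (x, 0))) =
      p * ∑ i ∈ Finset.range k, s i * geomListE k r fun x => φ (serve i x) := by
    rw [← Finset.sum_range_reflect, Finset.mul_sum]
    refine Finset.sum_congr rfl fun i hi => ?_
    have hi := Finset.mem_range.mp hi
    rw [has i hi, mul_assoc]
    simp only [show k - 1 - i < k by omega, if_true, show k - 1 - (k - 1 - i) = i by omega]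
  have h₂ : ∑ j ∈ Finset.range k, a j = p * ∑ i ∈ Finset.range k, s i := by
    rw [← Finset.sum_range_reflect, Finset.mul_sum]
    exact Finset.sum_congr rfl fun i hi => has i (Finset.mem_range.mp hi)
  have h₃ : ∀ i ∈ Finset.range m, a (k.succ + i) * geomListE k r (fun x => φ (if k.succ + i < k then
        serve (k - 1 - (k.succ + i)) x else if k.succ + i = k then push x else (x, 0))) =
      a (k.succ + i) * G := fun i _ => by
    simp only [show ¬ k.succ + i < k by omega, show ¬ k.succ + i = k by omega, if_false, hG₀]
  rw [Finset.sum_range_add, Finset.sum_range_succ, h₂, hδ] at ha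
  rw [Finset.sum_range_add, Finset.sum_congr rfl h₃, ← Finset.sum_mul, Finset.sum_range_succ, h₁]
  simp only [lt_irrefl, if_false, if_true]
  set Q := ∑ i ∈ Finset.range k, s i * geomListE k r fun x => φ (serve i x)
  set R := ∑ i ∈ Finset.range m, a (k.succ + i)
  set S := ∑ i ∈ Finset.range k, s i
  calc p + G = p + (p * S + (p + δ) + R) * G := by rw [ha, one_mul]
    _ = p * (S * G + (1 + G)) + δ * G + R * G := by ring
    _ ≤ p * (S * G + (1 + G)) + δ * P + R * G := by gcongr
    _ = p * Q + (p + δ) * P + R * G := by rw [← hst]; ring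
    _ = _ := by rw [hδ]

/-- Queues that start with `x.sum` customers release at most `x.sum` more than empty ones, which
costs the stationary mean once. -/
theorem le_wordE_tandem (hk : k < d) (ha : ∑ j ∈ Finset.range d, a j = 1)
    {s : ℕ → ℝ≥0∞} (hr : ∀ i < k, r i < 1) (hrs : ∀ i < k, s i * r i = 1)
    (has : ∀ i < k, a (k - 1 - i) = p * s i) (hpk : p ≤ a k) (n : ℕ) :
    p * n ≤ ∑ i ∈ Finset.range k, r i / (1 - r i) +
      wordE (fun j : Fin d => a j) n
        (fun w => (w.foldl (tandemStep k) (fun _ => 0) 0 : ℝ≥0∞)) := by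
  have h : p * n ≤ geomListE k r (queueValue d k a n) := by
    induction n with
    | zero => simp
    | succ n ih =>
      refine le_trans ?_ (le_geomListE_queueValue_succ hk ha hr hrs has hpk n)
      calc p * ((n + 1 : ℕ) : ℝ≥0∞) = p + p * n := by push_cast; ring
        _ ≤ _ := by gcongr
  refine h.trans ?_
  rw [← geomListE_sum_natCast hr, ← geomListE_const hr (wordE _ n _), ← geomListE_add]
  refine geomListE_mono fun x hx => ?_
  rw [queueValue, ← wordE_const_add (by rw [← ha, Fin.sum_univ_eq_sum_range])]
  refine wordE_mono _ _ fun w => ?_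
  have hx' : passed k x ≤ fun _ => x.sum + 0 := fun i => by
    simpa [passed] using (List.drop_sublist (k - i) x).sum_le_sum fun _ _ => Nat.zero_le _
  have := foldl_tandemStep_mono k hx' w 0
  rw [foldl_tandemStep_add k (fun _ => 0)] at this
  exact_mod_cast this

end Bounds

end RSK

namespace RSK

open scoped ENNReal

/-! ### Passage to real expectations. -/

section Expectation

variable {d : ℕ}

/-- The expectation of `F` under the law of a word of `n` independent letters, with `α` the
probabilities of the letters. -/
noncomputable def expect (α : Fin d → ℝ) (n : ℕ) (F : (Fin n → Fin d) → ℕ) : ℝ :=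
  ∑ w, (∏ i, α (w i)) * F w

theorem expect_nonneg {α : Fin d → ℝ} (hα : 0 ≤ α) (n : ℕ) (F : (Fin n → Fin d) → ℕ) :
    0 ≤ expect α n F :=
  Finset.sum_nonneg fun w _ => mul_nonneg (Finset.prod_nonneg fun i _ => hα (w i)) (by positivity)

theorem expect_mono {α : Fin d → ℝ} (hα : 0 ≤ α) {n : ℕ} {F F' : (Fin n → Fin d) → ℕ}
    (h : ∀ w, F w ≤ F' w) : expect α n F ≤ expect α n F' :=
  Finset.sum_le_sum fun w _ => mul_le_mul_of_nonneg_left (by exact_mod_cast h w)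
    (Finset.prod_nonneg fun i _ => hα (w i))

theorem wordE_ofReal {α : Fin d → ℝ} (hα : 0 ≤ α) (n : ℕ) (F : List (Fin d) → ℕ) :
    wordE (fun j => ENNReal.ofReal (α j)) n (fun w => (F w : ℝ≥0∞)) =
      ENNReal.ofReal (expect α n fun w => F (List.ofFn w)) := by
  rw [wordE_eq_sum, expect, ENNReal.ofReal_sum_of_nonneg]
  · refine Finset.sum_congr rfl fun w _ => ?_
    rw [ENNReal.ofReal_mul (Finset.prod_nonneg fun i _ => hα (w i)),
      ENNReal.ofReal_prod_of_nonneg fun i _ => hα (w i), ENNReal.ofReal_natCast]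
  · exact fun w _ => mul_nonneg (Finset.prod_nonneg fun i _ => hα (w i)) (by positivity)

theorem letterLaw_singleton (α : Fin d → ℝ) (i : Fin d) :
    letterLaw α {i} = ENNReal.ofReal (α i) := by
  simp [letterLaw, Measure.finsetSum_apply, Set.indicator_apply]

instance isFiniteMeasure_letterLaw (α : Fin d → ℝ) : IsFiniteMeasure (letterLaw α) where
  measure_univ_lt_top := by simp [letterLaw]

theorem integral_schurWeyl {α : Fin d → ℝ} (hα : 0 ≤ α) (n : ℕ) (k : Fin d) :
    ∫ l, (l k : ℝ) ∂(schurWeyl n α) = expect α n fun w => shape w k := by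
  have hm : Measurable fun l : Fin d → ℕ => (l k : ℝ) :=
    measurable_from_nat.comp (measurable_pi_apply k)
  have : IsFiniteMeasure (wordLaw n α) := by unfold wordLaw; infer_instance
  rw [schurWeyl, integral_map (measurable_of_countable _).aemeasurable hm.aestronglyMeasurable,
    integral_fintype Integrable.of_finite]
  refine Finset.sum_congr rfl fun w _ => ?_
  rw [smul_eq_mul, measureReal_def, wordLaw, Measure.pi_singleton]
  simp only [letterLaw_singleton, ENNReal.toReal_prod]
  congr 1
  exact Finset.prod_congr rfl fun i _ => ENNReal.toReal_ofReal (hα (w i))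

end Expectation

/-! ### Choice of the rates and optimisation in `δ`. -/

section RealBounds

variable {d : ℕ} {α : Fin d → ℝ}

/-- The extension of the letter probabilities by zero. -/
def extend (α : Fin d → ℝ) (j : ℕ) : ℝ := if h : j < d then α ⟨j, h⟩ else 0

@[simp]
theorem extend_val (α : Fin d → ℝ) (j : Fin d) : extend α j = α j := by simp [extend]

theorem extend_nonneg (hα : 0 ≤ α) (j : ℕ) : 0 ≤ extend α j := by
  unfold extend
  split_ifs
  exacts [hα _, le_rfl]

theorem sum_ofReal_extend (hα : α ∈ stdSimplex ℝ (Fin d)) :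
    ∑ j ∈ Finset.range d, ENNReal.ofReal (extend α j) = 1 := by
  rw [← Fin.sum_univ_eq_sum_range (fun j => ENNReal.ofReal (extend α j))]
  simp only [extend_val]
  rw [← ENNReal.ofReal_sum_of_nonneg fun j _ => hα.1 j, hα.2, ENNReal.ofReal_one]

theorem sum_extend_Ici (α : Fin d → ℝ) (k : Fin d) :
    ∑ i ∈ Finset.range (d - k), extend α (k + i) = ∑ i ∈ Finset.Ici k, α i := by
  have h₁ : ∑ i ∈ Finset.Ici k, α i = ∑ j : Fin d, if k ≤ j then α j else 0 := by
    rw [← Finset.sum_filter]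
    congr 1
    ext; simp
  have h₂ : ∑ j : Fin d, (if k ≤ j then α j else 0) =
      ∑ j ∈ Finset.range (k + (d - k)), if k.val ≤ j then extend α j else 0 := by
    rw [show k.val + (d - k) = d by omega,
      ← Fin.sum_univ_eq_sum_range fun j => if k.val ≤ j then extend α j else 0]
    simp
  have h₃ : ∑ j ∈ Finset.range k, (if k.val ≤ j then extend α j else 0) = 0 :=
    Finset.sum_eq_zero fun j hj => if_neg (not_le.mpr (Finset.mem_range.mp hj))
  rw [h₁, h₂, Finset.sum_range_add, h₃, zero_add]
  simp

theorem ofReal_div_one_sub {x y : ℝ} (hx : 0 ≤ x) (hxy : x < y) :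
    ENNReal.ofReal (x / y) / (1 - ENNReal.ofReal (x / y)) = ENNReal.ofReal (x / (y - x)) := by
  have hy : 0 < y := hx.trans_lt hxy
  have h : 0 < 1 - x / y := by rw [sub_pos, div_lt_one hy]; exact hxy
  rw [← ENNReal.ofReal_one, ← ENNReal.ofReal_sub _ (by positivity), ← ENNReal.ofReal_div_of_pos h]
  congr 1
  have : y - x ≠ 0 := by linarith
  field_simp

/-- With `p = α k + δ` every ratio is below `1`, and the mean `α i / (p - α i)` is at most `α i / δ`
because `α i ≤ α k`. -/
theorem expect_lisFrom_le_add (hα : α ∈ stdSimplex ℝ (Fin d)) (hanti : Antitone α) (k : Fin d)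
    (n : ℕ) {δ : ℝ} (hδ : 0 < δ) :
    expect α n (fun w => lisFrom k (List.ofFn w)) ≤
      (α k + δ) * n + (∑ i ∈ Finset.Ici k, α i) / δ := by
  have hα0 : 0 ≤ α := hα.1
  have hP : 0 < α k + δ := add_pos_of_nonneg_of_pos (hα0 k) hδ
  have hle : ∀ i, extend α (k + i) ≤ α k := fun i => by
    unfold extend
    split_ifs with h
    · exact hanti (Fin.le_def.mpr (by simp))
    · exact hα0 k
  have hnn := extend_nonneg hα0
  have h := wordE_lisFrom_le (a := fun j => ENNReal.ofReal (extend α j))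
    (p := ENNReal.ofReal (α k + δ)) (r := fun i => ENNReal.ofReal (extend α (k + i) / (α k + δ)))
    k.isLt.le (sum_ofReal_extend hα) ENNReal.ofReal_ne_top
    (fun i _ => by
      rw [ENNReal.ofReal_lt_one, div_lt_one hP]
      linarith [hle i])
    (fun i _ => by
      rw [← ENNReal.ofReal_mul hP.le, mul_div_cancel₀ _ hP.ne']) n
  simp only [extend_val] at h
  rw [wordE_ofReal hα0] at h
  have hsum : ∑ i ∈ Finset.range (d - k), ENNReal.ofReal (extend α (k + i) / (α k + δ)) /
      (1 - ENNReal.ofReal (extend α (k + i) / (α k + δ))) ≤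
      ENNReal.ofReal ((∑ i ∈ Finset.Ici k, α i) / δ) := by
    rw [← sum_extend_Ici, Finset.sum_div,
      ENNReal.ofReal_sum_of_nonneg fun i _ => div_nonneg (hnn _) hδ.le]
    refine Finset.sum_le_sum fun i _ => ?_
    rw [ofReal_div_one_sub (hnn _) (by linarith [hle i])]
    exact ENNReal.ofReal_le_ofReal
      (div_le_div_of_nonneg_left (hnn _) hδ (by linarith [hle i]))
  have hβ : 0 ≤ (∑ i ∈ Finset.Ici k, α i) / δ :=
    div_nonneg (Finset.sum_nonneg fun i _ => hα0 i) hδ.le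
  refine (ENNReal.ofReal_le_ofReal_iff (by positivity)).mp (h.trans ?_)
  rw [ENNReal.ofReal_add (by positivity) hβ, ENNReal.ofReal_mul hP.le, ENNReal.ofReal_natCast]
  gcongr

/-- With `p = α k - δ`, each of the `k` queues has mean length `p / (α j - p) ≤ α k / δ`. -/
theorem le_expect_tandem_add (hα : α ∈ stdSimplex ℝ (Fin d)) (hanti : Antitone α) (k : Fin d)
    (n : ℕ) {δ : ℝ} (hδ : 0 < δ) (hδk : δ < α k) :
    (α k - δ) * n ≤ k * α k / δ +
      expect α n (fun w => (List.ofFn w).foldl (tandemStep k) (fun _ => 0) 0) := by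
  have hα0 : 0 ≤ α := hα.1
  have hP : 0 < α k - δ := by linarith
  have hge : ∀ i < k.val, α k ≤ extend α (k - 1 - i) := fun i hi => by
    unfold extend
    rw [dif_pos (by omega)]
    exact hanti (Fin.le_def.mpr (by simp; omega))
  have h := le_wordE_tandem (a := fun j => ENNReal.ofReal (extend α j))
    (p := ENNReal.ofReal (α k - δ))
    (r := fun i => ENNReal.ofReal ((α k - δ) / extend α (k - 1 - i)))
    (s := fun i => ENNReal.ofReal (extend α (k - 1 - i) / (α k - δ)))
    k.isLt (sum_ofReal_extend hα)
    (fun i hi => by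
      have := hge i hi
      rw [ENNReal.ofReal_lt_one, div_lt_one (by linarith)]
      linarith)
    (fun i hi => by
      have := hge i hi
      have : extend α (k - 1 - i) ≠ 0 := by linarith
      have : α k - δ ≠ 0 := hP.ne'
      rw [← ENNReal.ofReal_mul (div_nonneg (extend_nonneg hα0 _) hP.le), ← ENNReal.ofReal_one]
      congr 1
      field_simp)
    (fun i hi => by
      rw [← ENNReal.ofReal_mul hP.le, mul_div_cancel₀ _ hP.ne'])
    (by
      simp only [extend_val]
      exact ENNReal.ofReal_le_ofReal (by linarith)) n
  simp only [extend_val] at h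
  rw [wordE_ofReal hα0 n fun w => w.foldl (tandemStep k) (fun _ => 0) 0] at h
  have hsum : ∑ i ∈ Finset.range k, ENNReal.ofReal ((α k - δ) / extend α (k - 1 - i)) /
      (1 - ENNReal.ofReal ((α k - δ) / extend α (k - 1 - i))) ≤
      ENNReal.ofReal (k * α k / δ) := by
    have hc : ENNReal.ofReal (k * α k / δ) =
        ∑ _i ∈ Finset.range k.val, ENNReal.ofReal (α k / δ) := by
      rw [Finset.sum_const, Finset.card_range, nsmul_eq_mul, mul_div_assoc,
        ENNReal.ofReal_mul (by positivity), ENNReal.ofReal_natCast]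
    rw [hc]
    refine Finset.sum_le_sum fun i hi => ?_
    have := hge i (Finset.mem_range.mp hi)
    rw [ofReal_div_one_sub hP.le (by linarith)]
    exact ENNReal.ofReal_le_ofReal (div_le_div₀ (hα0 k) (by linarith) hδ (by linarith))
  have hE := expect_nonneg hα0 n fun w => (List.ofFn w).foldl (tandemStep k) (fun _ => 0) 0
  have hk0 : 0 ≤ k * α k / δ := div_nonneg (mul_nonneg (by positivity) (hα0 k)) hδ.le
  refine (ENNReal.ofReal_le_ofReal_iff (add_nonneg hk0 hE)).mp ?_
  rw [ENNReal.ofReal_add hk0 hE, ENNReal.ofReal_mul hP.le, ENNReal.ofReal_natCast]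
  exact h.trans (by gcongr)

theorem le_add_two_mul_sqrt {E A β x : ℝ} (hβ : 0 ≤ β) (hx : 0 ≤ x)
    (h : ∀ δ > 0, E ≤ (A + δ) * x + β / δ) : E ≤ A * x + 2 * √(β * x) := by
  rcases hβ.eq_or_lt with rfl | hβ
  · refine le_of_forall_pos_le_add fun ε hε => ?_
    have h₁ := h (ε / (x + 1)) (by positivity)
    have h₂ : ε / (x + 1) * x ≤ ε := by
      rw [div_mul_eq_mul_div, div_le_iff₀ (by positivity)]
      nlinarith
    simp only [zero_div, add_zero, zero_mul, Real.sqrt_zero, mul_zero] at *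
    linarith
  rcases hx.eq_or_lt with rfl | hx
  · refine le_of_forall_pos_le_add fun ε hε => ?_
    have h₁ := h (β / ε) (by positivity)
    rw [div_div_cancel₀ hβ.ne'] at h₁
    simpa using h₁
  · have hs : 0 < √(β * x) := Real.sqrt_pos.mpr (by positivity)
    have hsq : √(β * x) * √(β * x) = β * x := Real.mul_self_sqrt (by positivity)
    -- The minimiser `δ = √(β / x)`; for `β = 0` or `x = 0` it degenerates, hence the separate
    -- limits above.
    have h₁ := h (√(β * x) / x) (by positivity)
    have h₂ : β / (√(β * x) / x) = √(β * x) := by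
      rw [div_div_eq_mul_div, div_eq_iff hs.ne', hsq]
    have h₃ : √(β * x) / x * x = √(β * x) := div_mul_cancel₀ _ hx.ne'
    rw [h₂, add_mul, h₃] at h₁
    linarith

theorem sub_two_mul_sqrt_le {E A κ x : ℝ} (hE : 0 ≤ E) (hA : 0 ≤ A) (hκ : 0 ≤ κ)
    (h : ∀ δ > 0, δ < A → (A - δ) * x ≤ κ * A / δ + E) :
    A * x - 2 * √(A * (κ + 1) * x) ≤ E := by
  set D := √(A * (κ + 1) * x) with hD
  have hD0 : 0 ≤ D := Real.sqrt_nonneg _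
  -- If `A * x ≤ 2 * D`, then `0 ≤ E` suffices; otherwise `δ = D / x` is below `A`. Having `κ + 1`
  -- in `D` keeps `δ` positive even for `κ = 0`.
  rcases le_or_gt (A * x) (2 * D) with hle | hlt
  · linarith
  have hAx : 0 < A * x := by linarith
  have hx : 0 < x := pos_of_mul_pos_right hAx hA
  have hA : 0 < A := pos_of_mul_pos_left hAx hx.le
  have hsq : D * D = A * (κ + 1) * x := Real.mul_self_sqrt (by positivity)
  have hDpos : 0 < D := Real.sqrt_pos.mpr (by positivity)
  have h₁ := h (D / x) (by positivity) (by rw [div_lt_iff₀ hx]; linarith)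
  have h₂ : κ * A / (D / x) ≤ D := by
    rw [div_div_eq_mul_div, div_le_iff₀ hDpos]
    nlinarith
  have h₃ : D / x * x = D := div_mul_cancel₀ _ hx.ne'
  rw [sub_mul, h₃] at h₁
  linarith

theorem expect_lisFrom_le (hα : α ∈ stdSimplex ℝ (Fin d)) (hanti : Antitone α) (k : Fin d)
    (n : ℕ) :
    expect α n (fun w => lisFrom k (List.ofFn w)) ≤
      α k * n + 2 * √((∑ i ∈ Finset.Ici k, α i) * n) :=
  le_add_two_mul_sqrt (Finset.sum_nonneg fun i _ => hα.1 i) n.cast_nonneg fun _ hδ =>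
    expect_lisFrom_le_add hα hanti k n hδ

theorem le_expect_tandem (hα : α ∈ stdSimplex ℝ (Fin d)) (hanti : Antitone α) (k : Fin d)
    (n : ℕ) :
    α k * n - 2 * √(α k * ((k : ℕ) + 1 : ℝ) * n) ≤
      expect α n (fun w => (List.ofFn w).foldl (tandemStep k) (fun _ => 0) 0) :=
  sub_two_mul_sqrt_le (expect_nonneg hα.1 _ _) (hα.1 k) (by positivity)
    fun _ hδ hδk => le_expect_tandem_add hα hanti k n hδ hδk

theorem sum_Ici_le_min (hα : α ∈ stdSimplex ℝ (Fin d)) (hanti : Antitone α) (k : Fin d) :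
    ∑ i ∈ Finset.Ici k, α i ≤ min 1 (α k * d) := by
  refine le_min ?_ ?_
  · rw [← hα.2]
    exact Finset.sum_le_univ_sum_of_nonneg hα.1
  · calc ∑ i ∈ Finset.Ici k, α i ≤ ∑ _i ∈ Finset.Ici k, α k :=
          Finset.sum_le_sum fun i hi => hanti (Finset.mem_Ici.mp hi)
      _ ≤ ∑ _i : Fin d, α k := Finset.sum_le_univ_sum_of_nonneg fun _ => hα.1 k
      _ = α k * d := by simp [mul_comm]

theorem mul_succ_le_min (hα : α ∈ stdSimplex ℝ (Fin d)) (hanti : Antitone α) (k : Fin d) :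
    α k * ((k : ℕ) + 1 : ℝ) ≤ min 1 (α k * d) := by
  refine le_min ?_ ?_
  · calc α k * ((k : ℕ) + 1 : ℝ) = ∑ _i ∈ Finset.Iic k, α k := by simp [mul_comm]
      _ ≤ ∑ i ∈ Finset.Iic k, α i :=
          Finset.sum_le_sum fun i hi => hanti (Finset.mem_Iic.mp hi)
      _ ≤ 1 := by
          rw [← hα.2]
          exact Finset.sum_le_univ_sum_of_nonneg hα.1
  · exact mul_le_mul_of_nonneg_left (by exact_mod_cast k.isLt) (hα.1 k)

end RealBounds

/-! ### Uniform permutations as a limit of uniform words. -/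

section Permutations

theorem lis_le_lisFrom {n d : ℕ} (π : Equiv.Perm (Fin n)) {v : Fin n → Fin d} (hv : Monotone v) :
    lis π ≤ lisFrom 0 (List.ofFn (v ∘ π)) := by
  classical
  refine Finset.sup_le fun s hs => ?_
  have hs : MonotoneOn π s := by simpa using hs
  have h := length_le_lisFrom 0 (r := ((List.finRange n).filter (· ∈ s)).map (v ∘ π))
    (w := List.ofFn (v ∘ π)) (by rw [List.ofFn_eq_map]; exact List.filter_sublist.map _) ?_
    (fun _ _ => Nat.zero_le _)
  · refine le_trans (le_of_eq ?_) h
    rw [List.length_map, ← List.toFinset_card_of_nodup ((List.nodup_finRange n).filter _)]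
    congr 1
    ext; simp
  · rw [List.pairwise_map]
    refine ((List.pairwise_lt_finRange n).filter _).imp_of_mem fun {i j} hi hj hij => ?_
    exact hv (hs (by simpa using hi) (by simpa using hj) hij.le)

theorem pow_mul_sum_lis_le (n d : ℕ) :
    (d ^ n) * ∑ π : Equiv.Perm (Fin n), lis π ≤
      n.factorial * ∑ w : Fin n → Fin d, lisFrom 0 (List.ofFn w) := by
  have h₁ : ∀ w : Fin n → Fin d, ∑ π : Equiv.Perm (Fin n), lis π ≤
      ∑ π : Equiv.Perm (Fin n), lisFrom 0 (List.ofFn (w ∘ π)) := fun w => by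
    -- Sorting `w` gives a monotone relabelling of the values of `π`, which keeps increasing
    -- subsequences weakly increasing; the sorting permutation is then absorbed into the sum over
    -- `π`.
    refine (Finset.sum_le_sum fun π _ => lis_le_lisFrom π (Tuple.monotone_sort w)).trans_eq ?_
    exact Equiv.sum_comp (Equiv.mulLeft (Tuple.sort w)) fun π : Equiv.Perm (Fin n) =>
      lisFrom 0 (List.ofFn (w ∘ π))
  calc (d ^ n) * ∑ π : Equiv.Perm (Fin n), lis π
      = ∑ _w : Fin n → Fin d, ∑ π : Equiv.Perm (Fin n), lis π := by simp
    _ ≤ ∑ w : Fin n → Fin d, ∑ π : Equiv.Perm (Fin n), lisFrom 0 (List.ofFn (w ∘ π)) :=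
        Finset.sum_le_sum fun w _ => h₁ w
    _ = ∑ π : Equiv.Perm (Fin n), ∑ w : Fin n → Fin d, lisFrom 0 (List.ofFn (w ∘ π)) :=
        Finset.sum_comm
    _ = ∑ _π : Equiv.Perm (Fin n), ∑ w : Fin n → Fin d, lisFrom 0 (List.ofFn w) :=
        Finset.sum_congr rfl fun π _ =>
          (Equiv.arrowCongr π.symm (Equiv.refl (Fin d))).sum_comp fun w => lisFrom 0 (List.ofFn w)
    _ = _ := by simp [Fintype.card_perm]

theorem expectedLisPerm_le_add (n d : ℕ) :
    expectedLisPerm n ≤ 1 / ((d : ℝ) + 1) * n + 2 * √n := by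
  set α : Fin (d + 1) → ℝ := fun _ => 1 / ((d : ℝ) + 1) with hα
  have hd : (0 : ℝ) < (d : ℝ) + 1 := by positivity
  have hα1 : ∑ i, α i = 1 := by simp [hα, hd.ne']
  have h := expect_lisFrom_le (α := α) ⟨fun i => by positivity, hα1⟩
    antitone_const 0 n
  rw [show Finset.Ici (0 : Fin (d + 1)) = Finset.univ by ext; simp, hα1, one_mul] at h
  refine le_trans ?_ h
  rw [expectedLisPerm, div_le_iff₀ (by positivity)]
  have h₁ : ((d : ℝ) + 1) ^ n * ∑ π : Equiv.Perm (Fin n), (lis π : ℝ) ≤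
      n.factorial * ∑ w : Fin n → Fin (d + 1), (lisFrom 0 (List.ofFn w) : ℝ) := by
    exact_mod_cast pow_mul_sum_lis_le n (d + 1)
  have h₂ : expect α n (fun w => lisFrom (0 : Fin (d + 1)) (List.ofFn w)) =
      (∑ w : Fin n → Fin (d + 1), (lisFrom 0 (List.ofFn w) : ℝ)) / ((d : ℝ) + 1) ^ n := by
    simp [expect, hα, Finset.mul_sum, div_eq_inv_mul]
  rw [h₂, div_mul_eq_mul_div, le_div_iff₀ (by positivity)]
  linarith

theorem expectedLisPerm_le (n : ℕ) : expectedLisPerm n ≤ 2 * √(n : ℝ) := by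
  have h : Filter.Tendsto (fun d : ℕ => 1 / ((d : ℝ) + 1) * n + 2 * √n) Filter.atTop
      (nhds (0 * n + 2 * √n)) :=
    (tendsto_one_div_add_atTop_nhds_zero_nat.mul_const _).add_const _
  simpa using ge_of_tendsto' h (expectedLisPerm_le_add n)

end Permutations

end RSK

theorem theorem1 (n : ℕ) :
    (∀ (d : ℕ) (α : Fin d → ℝ), α ∈ stdSimplex ℝ (Fin d) → Antitone α → ∀ k : Fin d,
      (α k * n - 2 * √(min 1 (α k * d) * n) ≤ ∫ l, (l k : ℝ) ∂(schurWeyl n α) ∧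
        ∫ l, (l k : ℝ) ∂(schurWeyl n α) ≤ α k * n + 2 * √(min 1 (α k * d) * n)) ∧
      (α k * n - 2 * √(α k * ((k : ℕ) + 1 : ℝ) * n) ≤ ∫ l, (l k : ℝ) ∂(schurWeyl n α) ∧
        ∫ l, (l k : ℝ) ∂(schurWeyl n α) ≤ α k * n + 2 * √((∑ i ∈ Finset.Ici k, α i) * n))) ∧
    expectedLisPerm n ≤ 2 * √(n : ℝ) := by
  refine ⟨fun d α hα hanti k => ?_, RSK.expectedLisPerm_le n⟩
  rw [RSK.integral_schurWeyl hα.1]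
  have hlow := (RSK.le_expect_tandem hα hanti k n).trans
    (RSK.expect_mono hα.1 fun w => RSK.foldl_tandemStep_le_shape w k)
  have hupp := (RSK.expect_mono hα.1 fun w => RSK.shape_le_lisFrom w k).trans
    (RSK.expect_lisFrom_le hα hanti k n)
  refine ⟨⟨le_trans ?_ hlow, hupp.trans ?_⟩, hlow, hupp⟩
  · have := RSK.mul_succ_le_min hα hanti k
    gcongr
  · have := RSK.sum_Ici_le_min hα hanti k
    gcongr
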